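/- **Soundness of Match Coverage.** *Syntax.* Sorts are $\kappa ::= \star \mid \mathbb N$. Types are $A ::= 1 \mid \alpha \mid \hat\alpha \mid A\to A \mid A+A \mid A\times A \mid \mathsf{Vec}\,t\,A \mid \forall\alpha{:}\kappa.A \mid \exists\alpha{:}\kappa.A \mid P\supset A \mid A\wedge P$ with universal variables $\alpha$ and existential variables $\hat\alpha$; monotypes and index terms are $t,\sigma,\tau ::= \mathsf{zero}\mid\mathsf{succ}(t)\mid 1\mid\alpha\mid\hat\alpha\mid\tau\oplus\sigma$ with $\oplus\in\{\to,+,\times\}$; propositions are equations $P ::= (t=t')$. Patterns are $\rho ::= z\mid \_\mid ()\mid\langle\rho_1,\rho_2\rangle\mid\mathsf{inj}_1\rho\mid\mathsf{inj}_2\rho\mid[]\mid\rho_1::\rho_2$, and a branch list $\Pi$ is a finite list of branches $\vec\rho\Rightarrow e$. *Contexts.* An algorithmic context $\Gamma$ is a list of entries $u:\kappa$ (with $u$ an $\alpha$ or an $\hat\alpha$), $x:A\,p$ ($p$ a principality), $\hat\alpha:\kappa=\tau$, $\alpha=\tau$, and markers. It acts as a substitution $[\Gamma]$: $[\Gamma,\alpha=\tau]=[[\Gamma]\tau/\alpha]\circ[\Gamma]$,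 $[\Gamma,\hat\alpha:\kappa=\tau]=[[\Gamma]\tau/\hat\alpha]\circ[\Gamma]$, other entries being skipped. $\Gamma$ is well-formed if no variable is declared twice, no universal variable has two equations, no marker is repeated, and every type and every right-hand side is well-formed (well-sorted) over the entries to its left, where $\alpha$ must be declared before an equation $\alpha=\tau$. $\Omega$ is complete if every existential variable in it is solved. A declarative context $\Psi$ has only entries $\alpha:\kappa$ and $x:A\,p$. We write $\Gamma\vdash\vec A\,!\ \mathit{types}$ if every $A$ in $\vec A$ is a well-formed type over $\Gamma$ and $[\Gamma]A$ has no free existential variable. *Extension.* $\Gamma\longrightarrow\Delta$ is generated by $\cdot\longrightarrow\cdot$ and, from $\Gamma\longrightarrow\Delta$, by appending the same entry $u:\kappa$ or the same marker to both sides; appending $x:A\,p$ and $x:A'\,p$ with $[\Delta]A=[\Delta]A'$, or $\hat\alpha:\kappa=t$ and $\hat\alpha:\kappa=t'$, or $\alpha=t$ and $\alpha=t'$, with $[\Delta]t=[\Delta]t'$; appending $\hat\alpha:\kappa$ on the left and $\hat\alpha:\kappa=t$ on the right; and appending $\hat\alpha:\kappa$ or $\hat\alpha:\kappa=t$ on the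 right only. *Context application.* For complete $\Omega$ the declarative context $[\Omega]\Gamma$ is the partial operation that runs through both contexts in parallel: it keeps $\alpha:\kappa$, turns $x:A'\,p$ in $\Gamma$, opposite $x:A\,p$ in $\Omega$, into $x:[\Omega]A\,p$ (requiring $[\Omega]A=[\Omega]A'$), drops matching markers, drops solved existential variables (whether unsolved, solved compatibly, or absent in $\Gamma$), and $[\Omega,\alpha=t](\Gamma,\alpha=t')=[[\Omega]t/\alpha]([\Omega]\Gamma)$ when $[\Omega]t=[\Omega]t'$; substitution in a declarative context acts on the types of the hypotheses $x:A\,p$ and keeps its declarations. *Expansion.* Expansion acts branch by branch on the first pattern of each branch; below $z$ means a variable or wildcard, and an expansion is undefined on any other first pattern. $\Pi\leadsto_{\times}\Pi'$ replaces $\langle\rho_1,\rho_2\rangle$ by $\rho_1,\rho_2$ and $z$ by $\_,\_$. $\Pi\leadsto_{+}\Pi_L\,\|\,\Pi_R$ sends $\mathsf{inj}_1\rho$ to $\rho$ in $\Pi_L$, $\mathsf{inj}_2\rho$ to $\rho$ in $\Pi_R$, and $z$ to $\_$ in both. $\Pi\leadsto_{\mathsf{var}}\Pi'$ deletes $z$.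 $\Pi\leadsto_{1}\Pi'$ deletes $()$ or $z$. $\Pi\leadsto_{\mathsf{Vec}}\Pi_{[]}\,\|\,\Pi_{::}$ deletes $[]$ into $\Pi_{[]}$, sends $\rho_1::\rho_2$ to $\rho_1,\rho_2$ in $\Pi_{::}$, and sends $z$ both to its deletion in $\Pi_{[]}$ and to $\_,\_$ in $\Pi_{::}$. *Equality elimination.* $\Gamma/\sigma\doteq t:\kappa\dashv\Delta^\bot$, whose output is a context $\Delta$ or $\bot$, is generated by the rules: $\Gamma/\alpha\doteq\alpha:\kappa\dashv\Gamma$, $\Gamma/\mathsf{zero}\doteq\mathsf{zero}:\mathbb N\dashv\Gamma$ and $\Gamma/1\doteq1:\star\dashv\Gamma$; $\mathsf{succ}(\sigma)\doteq\mathsf{succ}(t):\mathbb N$ has the output of $\sigma\doteq t:\mathbb N$; if $\alpha\notin FV(t)$ and $\Gamma$ has no equation for $\alpha$, then $\Gamma/\alpha\doteq t:\kappa\dashv\Gamma,\alpha=t$, and likewise $\Gamma/t\doteq\alpha:\kappa\dashv\Gamma,\alpha=t$; if $t\ne\alpha$ and $\alpha\in FV(t)$, then $\alpha\doteq t$ and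 $t\doteq\alpha$ give $\bot$; $\sigma_1\oplus\sigma_2\doteq\tau_1\oplus\tau_2:\star$ first eliminates $\sigma_1\doteq\tau_1:\star$, giving $\bot$ if that does, and if that gives $\Theta$ it has the output of $\Theta/[\Theta]\sigma_2\doteq[\Theta]\tau_2:\star\dashv\Delta^\bot$; and terms with clashing head constructors ($\mathsf{zero}$ against $\mathsf{succ}$, $1$ against $\oplus$, or $\oplus$ against a different $\oplus'$) give $\bot$. *Coverage.* Algorithmic coverage $\Gamma\vdash\Pi\text{ covers }\vec A$ and $\Gamma/P\vdash\Pi\text{ covers }\vec A$ are defined by mutual induction. - $\Gamma\vdash(\cdot\Rightarrow e)\mid\Pi\text{ covers }\cdot$. - If $\Pi\leadsto_{\mathsf{var}}\Pi'$ and $\Gamma\vdash\Pi'\text{ covers }\vec A$, then $\Gamma\vdash\Pi\text{ covers }A,\vec A$. - If $\Pi\leadsto_{1}\Pi'$ and $\Gamma\vdash\Pi'\text{ covers }\vec A$, then $\Gamma\vdash\Pi\text{ covers }1,\vec A$. - If $\Pi\leadsto_{\times}\Pi'$ and $\Gamma\vdash\Pi'\text{ covers }A_1,A_2,\vec A$,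 then $\Gamma\vdash\Pi\text{ covers }(A_1\times A_2),\vec A$. - If $\Pi\leadsto_{+}\Pi_L\|\Pi_R$, $\Gamma\vdash\Pi_L\text{ covers }A_1,\vec A$ and $\Gamma\vdash\Pi_R\text{ covers }A_2,\vec A$, then $\Gamma\vdash\Pi\text{ covers }(A_1+A_2),\vec A$. - If $\Gamma,\alpha:\kappa\vdash\Pi\text{ covers }A,\vec A$ with $\alpha$ fresh, then $\Gamma\vdash\Pi\text{ covers }(\exists\alpha{:}\kappa.A),\vec A$. - If $\Gamma/P\vdash\Pi\text{ covers }A,\vec A$, then $\Gamma\vdash\Pi\text{ covers }(A\wedge P),\vec A$. - If $\Pi\leadsto_{\mathsf{Vec}}\Pi_{[]}\|\Pi_{::}$, $\Gamma/(t=\mathsf{zero})\vdash\Pi_{[]}\text{ covers }\vec A$ and, with $n$ fresh, $\Gamma,n:\mathbb N/(t=\mathsf{succ}(n))\vdash\Pi_{::}\text{ covers }A,\mathsf{Vec}\,n\,A,\vec A$, then $\Gamma\vdash\Pi\text{ covers }(\mathsf{Vec}\,t\,A),\vec A$. - If $\Gamma/[\Gamma]t_1\doteq[\Gamma]t_2:\kappa\dashv\Delta$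 and $\Delta\vdash[\Delta]\Pi\text{ covers }[\Delta]\vec A$, then $\Gamma/(t_1=t_2)\vdash\Pi\text{ covers }\vec A$. - If $\Gamma/[\Gamma]t_1\doteq[\Gamma]t_2:\kappa\dashv\bot$, then $\Gamma/(t_1=t_2)\vdash\Pi\text{ covers }\vec A$. Declarative coverage $\Psi\vdash\Pi\text{ covers }\vec A$ and $\Psi/P\vdash\Pi\text{ covers }\vec A$ has the same rules with $\Psi$ for $\Gamma$, except that the last two are replaced by: if $\theta$ is an idempotent most general unifier of $t_1,t_2$ (a substitution for universal variables) and $\theta(\Psi)\vdash\theta(\Pi)\text{ covers }\theta(\vec A)$, then $\Psi/(t_1=t_2)\vdash\Pi\text{ covers }\vec A$; and if $t_1,t_2$ have no unifier, then $\Psi/(t_1=t_2)\vdash\Pi\text{ covers }\vec A$. **Theorem.** Let $\Gamma$ be a well-formed context and $\Omega$ a well-formed complete context with $\Gamma\longrightarrow\Omega$. Let $\vec A$ be a list of types with $\Gamma\vdash\vec A\,!\ \mathit{types}$ and $[\Gamma]\vec A=\vec A$, and let $\Pi$ be a branch list. 1. If $\Gamma\vdash\Pi\text{ covers }\vec A$,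 then $[\Omega]\Gamma$ is defined and $[\Omega]\Gamma\vdash\Pi\text{ covers }\vec A$. 2. If $P$ is a proposition with $[\Gamma]P=P$ and $\Gamma/P\vdash\Pi\text{ covers }\vec A$, then $[\Omega]\Gamma$ is defined and $[\Omega]\Gamma/P\vdash\Pi\text{ covers }\vec A$. -/

import Mathlib

namespace Bidir

/-! ## Syntax -/

/-- Sorts `κ`: `⋆` (types) and `ℕ` (natural-number indices). -/
inductive Sort' where
  | type
  | nat
  deriving DecidableEq

/-- Type-level variables `u`: universal variables `α` and existential variables `α̂`. -/
inductive TVar where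
  | u (α : ℕ)
  | e (a : ℕ)
  deriving DecidableEq

/-- The binary connectives `⊕`. -/
inductive BinOp where
  | arrow
  | sum
  | prod
  deriving DecidableEq

/-- Types `A` and index terms / monotypes `t, τ, σ` in one syntax; they are told apart by the
sorting and type well-formedness judgments below.  Binders are locally nameless: `all κ A` and
`ex κ A` bind the index `0` in `A`.  The only propositions are equations, so
`imp s t A` is `(s = t) ⊃ A` and `wth A s t` is `A ∧ (s = t)`. -/
inductive Ty where
  | bvar (i : ℕ)
  | fvar (v : TVar)
  | zero
  | succ (t : Ty)
  | one
  | bin (op : BinOp) (A B : Ty)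
  | vec (t A : Ty)
  | all (κ : Sort') (A : Ty)
  | ex (κ : Sort') (A : Ty)
  | imp (s t A : Ty)
  | wth (A s t : Ty)
  deriving DecidableEq

/-- Propositions `P ::= (t = t')`. -/
structure Prp where
  lhs : Ty
  rhs : Ty
  deriving DecidableEq

namespace Ty

/-- The universal variable `α` as a type or term. -/
abbrev uvar (α : ℕ) : Ty := .fvar (.u α)

/-- The existential variable `α̂` as a type or term. -/
abbrev evar (a : ℕ) : Ty := .fvar (.e a)

/-- Simultaneous substitution for free type-level variables. -/
def subst (σ : TVar → Ty) : Ty → Ty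
  | bvar i => bvar i
  | fvar v => σ v
  | zero => zero
  | succ t => succ (subst σ t)
  | one => one
  | bin op A B => bin op (subst σ A) (subst σ B)
  | vec t A => vec (subst σ t) (subst σ A)
  | all κ A => all κ (subst σ A)
  | ex κ A => ex κ (subst σ A)
  | imp s t A => imp (subst σ s) (subst σ t) (subst σ A)
  | wth A s t => wth (subst σ A) (subst σ s) (subst σ t)

/-- Replace the bound index `k` by `B`. -/
def openAt (B : Ty) : ℕ → Ty → Ty
  | k, bvar i => if i = k then B else bvar i
  | _, fvar v => fvar v
  | _, zero => zero
  | k, succ t => succ (openAt B k t)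
  | _, one => one
  | k, bin op A C => bin op (openAt B k A) (openAt B k C)
  | k, vec t A => vec (openAt B k t) (openAt B k A)
  | k, all κ A => all κ (openAt B (k + 1) A)
  | k, ex κ A => ex κ (openAt B (k + 1) A)
  | k, imp s t A => imp (openAt B k s) (openAt B k t) (openAt B k A)
  | k, wth A s t => wth (openAt B k A) (openAt B k s) (openAt B k t)

/-- The body of a quantified type, with the bound variable named `α`. -/
def openU (A : Ty) (α : ℕ) : Ty := openAt (uvar α) 0 A

/-- Free type-level variables, universal and existential. -/
def fv : Ty → Finset TVar
  | bvar _ => ∅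
  | fvar v => {v}
  | zero => ∅
  | succ t => fv t
  | one => ∅
  | bin _ A B => fv A ∪ fv B
  | vec t A => fv t ∪ fv A
  | all _ A => fv A
  | ex _ A => fv A
  | imp s t A => fv s ∪ fv t ∪ fv A
  | wth A s t => fv A ∪ fv s ∪ fv t

/-- `FEV(A) = ∅`: no free existential variables. -/
def NoFEV (A : Ty) : Prop := ∀ a : ℕ, TVar.e a ∉ A.fv

end Ty

/-- Substitution in propositions. -/
def Prp.subst (σ : TVar → Ty) (P : Prp) : Prp := ⟨P.lhs.subst σ, P.rhs.subst σ⟩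

/-- The one-variable substitution `[τ/v]`. -/
def single (v : TVar) (τ : Ty) : TVar → Ty := fun w => if w = v then τ else .fvar w

/-- Patterns `ρ ::= z | _ | () | ⟨ρ₁, ρ₂⟩ | inj₁ ρ | inj₂ ρ | [] | ρ₁ :: ρ₂`. -/
inductive Pat where
  | var (z : ℕ)
  | wild
  | unit
  | pair (ρ₁ ρ₂ : Pat)
  | inj₁ (ρ : Pat)
  | inj₂ (ρ : Pat)
  | nil
  | cons (ρ₁ ρ₂ : Pat)

mutual
/-- Expressions `e`. -/
inductive Exp where
  | var (x : ℕ)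
  | unit
  | lam (x : ℕ) (e : Exp)
  | app (e : Exp) (s : Spine)
  | recur (x : ℕ) (v : Exp)
  | anno (e : Exp) (A : Ty)
  | pair (e₁ e₂ : Exp)
  | inj₁ (e : Exp)
  | inj₂ (e : Exp)
  | matchOn (e : Exp) (B : Branches)
  | nil
  | cons (e₁ e₂ : Exp)
/-- Spines `s ::= · | e s`. -/
inductive Spine where
  | nil
  | cons (e : Exp) (s : Spine)
/-- Branch lists `Π ::= · | (ρ⃗ ⇒ e) | Π`. -/
inductive Branches where
  | nil
  | cons (ρs : List Pat) (e : Exp) (rest : Branches)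
end

mutual
/-- Substitution in expressions acts on the type annotations. -/
def Exp.subst (σ : TVar → Ty) : Exp → Exp
  | .var x => .var x
  | .unit => .unit
  | .lam x e => .lam x (e.subst σ)
  | .app e s => .app (e.subst σ) (s.subst σ)
  | .recur x v => .recur x (v.subst σ)
  | .anno e A => .anno (e.subst σ) (A.subst σ)
  | .pair e₁ e₂ => .pair (e₁.subst σ) (e₂.subst σ)
  | .inj₁ e => .inj₁ (e.subst σ)
  | .inj₂ e => .inj₂ (e.subst σ)
  | .matchOn e B => .matchOn (e.subst σ) (B.subst σ)
  | .nil => .nil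
  | .cons e₁ e₂ => .cons (e₁.subst σ) (e₂.subst σ)
/-- Substitution in spines. -/
def Spine.subst (σ : TVar → Ty) : Spine → Spine
  | .nil => .nil
  | .cons e s => .cons (e.subst σ) (s.subst σ)
/-- Substitution in branches. -/
def Branches.subst (σ : TVar → Ty) : Branches → Branches
  | .nil => .nil
  | .cons ρs e rest => .cons ρs (e.subst σ) (rest.subst σ)
end

/-! ## Contexts -/

/-- Principalities `p`: principal `!` and non-principal. -/
inductive Prin where
  | principal
  | nonprincipal
  deriving DecidableEq

/-- What a marker `▶` can carry: a type-level variable or a proposition. -/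
inductive Mark where
  | var (v : TVar)
  | prp (P : Prp)
  deriving DecidableEq

/-- Entries of algorithmic contexts: `u : κ`, `x : A p`, `α̂ : κ = τ`, `α = τ` and `▶`. -/
inductive Entry where
  | decl (v : TVar) (κ : Sort')
  | hyp (x : ℕ) (A : Ty) (p : Prin)
  | solved (a : ℕ) (κ : Sort') (τ : Ty)
  | eqn (α : ℕ) (τ : Ty)
  | marker (m : Mark)
  deriving DecidableEq

/-- Algorithmic contexts; the head of the list is the rightmost entry. -/
abbrev Ctx := List Entry

/-- Entries of declarative contexts: `α : κ` and `x : A p`. -/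
inductive DEntry where
  | decl (α : ℕ) (κ : Sort')
  | hyp (x : ℕ) (A : Ty) (p : Prin)

/-- Declarative contexts `Ψ`; the head of the list is the rightmost entry. -/
abbrev DCtx := List DEntry

/-- Substitution in a declarative context acts on the types of its hypotheses. -/
def DCtx.subst (σ : TVar → Ty) (Ψ : DCtx) : DCtx :=
  Ψ.map fun
    | .decl α κ => .decl α κ
    | .hyp x A p => .hyp x (A.subst σ) p

/-- An algorithmic context as a substitution:
`[Γ, α = τ] = [[Γ]τ/α] ∘ [Γ]` and `[Γ, α̂ : κ = τ] = [[Γ]τ/α̂] ∘ [Γ]`; other entries are skipped. -/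
def ctxSubst : Ctx → TVar → Ty
  | [] => Ty.fvar
  | .eqn α τ :: Γ => fun v =>
      (ctxSubst Γ v).subst (single (.u α) (τ.subst (ctxSubst Γ)))
  | .solved a _ τ :: Γ => fun v =>
      (ctxSubst Γ v).subst (single (.e a) (τ.subst (ctxSubst Γ)))
  | .decl _ _ :: Γ => ctxSubst Γ
  | .hyp _ _ _ :: Γ => ctxSubst Γ
  | .marker _ :: Γ => ctxSubst Γ

/-- `v ∈ dom(Γ)`: the variable `v` is declared, unsolved or solved, in `Γ`. -/
def InDom (v : TVar) (Γ : Ctx) : Prop :=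
  (∃ κ, Entry.decl v κ ∈ Γ) ∨ ∃ a κ τ, v = .e a ∧ Entry.solved a κ τ ∈ Γ

/-- `x ∈ dom(Γ)` for a term variable `x`. -/
def HypInDom (x : ℕ) (Γ : Ctx) : Prop := ∃ A p, Entry.hyp x A p ∈ Γ

/-- `(α = -) ∈ Γ`. -/
def HasEqn (α : ℕ) (Γ : Ctx) : Prop := ∃ τ, Entry.eqn α τ ∈ Γ

/-- Complete contexts `Ω`: every existential variable is solved. -/
def Complete (Ω : Ctx) : Prop := ∀ a κ, Entry.decl (.e a) κ ∉ Ω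

/-! ## Well-formedness -/

/-- Sorting `Γ ⊢ t : κ`. -/
inductive HasSort (Γ : Ctx) : Ty → Sort' → Prop
  | var {v : TVar} {κ : Sort'} : Entry.decl v κ ∈ Γ → HasSort Γ (.fvar v) κ
  | solvedVar {a : ℕ} {κ : Sort'} {τ : Ty} : Entry.solved a κ τ ∈ Γ → HasSort Γ (.evar a) κ
  | unit : HasSort Γ .one .type
  | bin {op : BinOp} {τ₁ τ₂ : Ty} :
      HasSort Γ τ₁ .type → HasSort Γ τ₂ .type → HasSort Γ (.bin op τ₁ τ₂) .type
  | zero : HasSort Γ .zero .nat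
  | succ {t : Ty} : HasSort Γ t .nat → HasSort Γ (.succ t) .nat

/-- Well-formed types `Γ ⊢ A type`.  Bound variables are opened with all but finitely many names. -/
inductive IsType : Ctx → Ty → Prop
  | var {Γ : Ctx} {v : TVar} : Entry.decl v .type ∈ Γ → IsType Γ (.fvar v)
  | solvedVar {Γ : Ctx} {a : ℕ} {τ : Ty} : Entry.solved a .type τ ∈ Γ → IsType Γ (.evar a)
  | unit {Γ : Ctx} : IsType Γ .one
  | bin {Γ : Ctx} {op : BinOp} {A B : Ty} : IsType Γ A → IsType Γ B → IsType Γ (.bin op A B)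
  | vec {Γ : Ctx} {t A : Ty} : HasSort Γ t .nat → IsType Γ A → IsType Γ (.vec t A)
  | all {Γ : Ctx} {κ : Sort'} {A : Ty} (L : Finset ℕ) :
      (∀ α, α ∉ L → IsType (.decl (.u α) κ :: Γ) (A.openU α)) → IsType Γ (.all κ A)
  | ex {Γ : Ctx} {κ : Sort'} {A : Ty} (L : Finset ℕ) :
      (∀ α, α ∉ L → IsType (.decl (.u α) κ :: Γ) (A.openU α)) → IsType Γ (.ex κ A)
  | imp {Γ : Ctx} {s t A : Ty} :
      HasSort Γ s .nat → HasSort Γ t .nat → IsType Γ A → IsType Γ (.imp s t A)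
  | wth {Γ : Ctx} {A s t : Ty} :
      HasSort Γ s .nat → HasSort Γ t .nat → IsType Γ A → IsType Γ (.wth A s t)

/-- `Γ ⊢ A ! type`: well-formed and principal, that is, `FEV([Γ]A) = ∅`. -/
def IsPrincipalType (Γ : Ctx) (A : Ty) : Prop :=
  IsType Γ A ∧ (A.subst (ctxSubst Γ)).NoFEV

/-- `Γ ⊢ A⃗ ! types`. -/
def ArePrincipalTypes (Γ : Ctx) (As : List Ty) : Prop := ∀ A ∈ As, IsPrincipalType Γ A

/-- Well-formed contexts `Γ ctx`. -/
inductive WF : Ctx → Prop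
  | empty : WF []
  | hyp {Γ : Ctx} {x : ℕ} {A : Ty} {p : Prin} :
      WF Γ → ¬ HypInDom x Γ → IsType Γ A → WF (.hyp x A p :: Γ)
  | decl {Γ : Ctx} {v : TVar} {κ : Sort'} : WF Γ → ¬ InDom v Γ → WF (.decl v κ :: Γ)
  | solved {Γ : Ctx} {a : ℕ} {κ : Sort'} {τ : Ty} :
      WF Γ → ¬ InDom (.e a) Γ → HasSort Γ τ κ → WF (.solved a κ τ :: Γ)
  | eqn {Γ : Ctx} {α : ℕ} {κ : Sort'} {τ : Ty} :
      WF Γ → Entry.decl (.u α) κ ∈ Γ → ¬ HasEqn α Γ → HasSort Γ τ κ → WF (.eqn α τ :: Γ)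
  | marker {Γ : Ctx} {m : Mark} : WF Γ → Entry.marker m ∉ Γ → WF (.marker m :: Γ)

/-! ## Context extension and context application -/

/-- Context extension `Γ ⟶ Δ`. -/
inductive Extends : Ctx → Ctx → Prop
  | id : Extends [] []
  | hyp {Γ Δ : Ctx} {x : ℕ} {A A' : Ty} {p : Prin} :
      Extends Γ Δ → A.subst (ctxSubst Δ) = A'.subst (ctxSubst Δ) →
      Extends (.hyp x A p :: Γ) (.hyp x A' p :: Δ)
  | uvar {Γ Δ : Ctx} {α : ℕ} {κ : Sort'} :
      Extends Γ Δ → Extends (.decl (.u α) κ :: Γ) (.decl (.u α) κ :: Δ)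
  | evar {Γ Δ : Ctx} {a : ℕ} {κ : Sort'} :
      Extends Γ Δ → Extends (.decl (.e a) κ :: Γ) (.decl (.e a) κ :: Δ)
  | solved {Γ Δ : Ctx} {a : ℕ} {κ : Sort'} {t t' : Ty} :
      Extends Γ Δ → t.subst (ctxSubst Δ) = t'.subst (ctxSubst Δ) →
      Extends (.solved a κ t :: Γ) (.solved a κ t' :: Δ)
  | solve {Γ Δ : Ctx} {a : ℕ} {κ : Sort'} {t : Ty} :
      Extends Γ Δ → Extends (.decl (.e a) κ :: Γ) (.solved a κ t :: Δ)
  | eqn {Γ Δ : Ctx} {α : ℕ} {t t' : Ty} :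
      Extends Γ Δ → t.subst (ctxSubst Δ) = t'.subst (ctxSubst Δ) →
      Extends (.eqn α t :: Γ) (.eqn α t' :: Δ)
  | marker {Γ Δ : Ctx} {m : Mark} :
      Extends Γ Δ → Extends (.marker m :: Γ) (.marker m :: Δ)
  | add {Γ Δ : Ctx} {a : ℕ} {κ : Sort'} : Extends Γ Δ → Extends Γ (.decl (.e a) κ :: Δ)
  | addSolved {Γ Δ : Ctx} {a : ℕ} {κ : Sort'} {t : Ty} :
      Extends Γ Δ → Extends Γ (.solved a κ t :: Δ)

open Classical in
/-- Applying a complete context `Ω` to a context `Γ`, giving a declarative context `[Ω]Γ`.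
The operation is partial; `none` means undefined. -/
noncomputable def ctxApply : Ctx → Ctx → Option DCtx
  | [], [] => some []
  | .hyp x A p :: Ω, .hyp x' A' p' :: Γ =>
      if x = x' ∧ p = p' ∧ A.subst (ctxSubst Ω) = A'.subst (ctxSubst Ω) then
        (ctxApply Ω Γ).map fun Ψ => .hyp x (A.subst (ctxSubst Ω)) p :: Ψ
      else none
  | .decl (.u α) κ :: Ω, .decl (.u α') κ' :: Γ =>
      if α = α' ∧ κ = κ' then (ctxApply Ω Γ).map fun Ψ => .decl α κ :: Ψ else none
  | .marker m :: Ω, .marker m' :: Γ => if m = m' then ctxApply Ω Γ else none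
  | .eqn α t :: Ω, .eqn α' t' :: Γ =>
      if α = α' ∧ t.subst (ctxSubst Ω) = t'.subst (ctxSubst Ω) then
        (ctxApply Ω Γ).map (DCtx.subst (single (.u α) (t.subst (ctxSubst Ω))))
      else none
  | .solved a κ t :: Ω, Γ =>
      if InDom (.e a) Γ then
        match Γ with
        | .decl (.e a') κ' :: Γ' => if a = a' ∧ κ = κ' then ctxApply Ω Γ' else none
        | .solved a' κ' t' :: Γ' =>
            if a = a' ∧ κ = κ' ∧ t.subst (ctxSubst Ω) = t'.subst (ctxSubst Ω) then
              ctxApply Ω Γ'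
            else none
        | _ => none
      else ctxApply Ω Γ
  | _, _ => none

/-! ## Equality elimination -/

/-- Head-constructor clash `σ # t`. -/
inductive Clash : Ty → Ty → Prop
  | zeroSucc {t : Ty} : Clash .zero (.succ t)
  | succZero {t : Ty} : Clash (.succ t) .zero
  | unitBin {op : BinOp} {τ₁ τ₂ : Ty} : Clash .one (.bin op τ₁ τ₂)
  | binUnit {op : BinOp} {τ₁ τ₂ : Ty} : Clash (.bin op τ₁ τ₂) .one
  | binBin {op op' : BinOp} {σ₁ σ₂ τ₁ τ₂ : Ty} :
      op ≠ op' → Clash (.bin op σ₁ σ₂) (.bin op' τ₁ τ₂)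

/-- Algorithmic equality elimination `Γ / σ ≗ t : κ ⊣ Δ⊥`; the output `none` is `⊥`. -/
inductive ElimEq : Ctx → Ty → Ty → Sort' → Option Ctx → Prop
  | uvarRefl {Γ : Ctx} {α : ℕ} {κ : Sort'} : ElimEq Γ (.uvar α) (.uvar α) κ (some Γ)
  | zero {Γ : Ctx} : ElimEq Γ .zero .zero .nat (some Γ)
  | succ {Γ : Ctx} {σ t : Ty} {Δ : Option Ctx} :
      ElimEq Γ σ t .nat Δ → ElimEq Γ (.succ σ) (.succ t) .nat Δ
  | uvarL {Γ : Ctx} {α : ℕ} {t : Ty} {κ : Sort'} :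
      TVar.u α ∉ t.fv → ¬ HasEqn α Γ → ElimEq Γ (.uvar α) t κ (some (.eqn α t :: Γ))
  | uvarR {Γ : Ctx} {α : ℕ} {t : Ty} {κ : Sort'} :
      TVar.u α ∉ t.fv → ¬ HasEqn α Γ → ElimEq Γ t (.uvar α) κ (some (.eqn α t :: Γ))
  | uvarLBot {Γ : Ctx} {α : ℕ} {t : Ty} {κ : Sort'} :
      t ≠ .uvar α → TVar.u α ∈ t.fv → ElimEq Γ (.uvar α) t κ none
  | uvarRBot {Γ : Ctx} {α : ℕ} {t : Ty} {κ : Sort'} :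
      t ≠ .uvar α → TVar.u α ∈ t.fv → ElimEq Γ t (.uvar α) κ none
  | unit {Γ : Ctx} : ElimEq Γ .one .one .type (some Γ)
  | bin {Γ Θ : Ctx} {op : BinOp} {σ₁ σ₂ τ₁ τ₂ : Ty} {Δ : Option Ctx} :
      ElimEq Γ σ₁ τ₁ .type (some Θ) →
      ElimEq Θ (σ₂.subst (ctxSubst Θ)) (τ₂.subst (ctxSubst Θ)) .type Δ →
      ElimEq Γ (.bin op σ₁ σ₂) (.bin op τ₁ τ₂) .type Δ
  | binBot {Γ : Ctx} {op : BinOp} {σ₁ σ₂ τ₁ τ₂ : Ty} :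
      ElimEq Γ σ₁ τ₁ .type none → ElimEq Γ (.bin op σ₁ σ₂) (.bin op τ₁ τ₂) .type none
  | clash {Γ : Ctx} {σ t : Ty} {κ : Sort'} : Clash σ t → ElimEq Γ σ t κ none

/-! ## Unification -/

/-- A substitution `θ` for universal variables, extended by the identity on existential ones. -/
def liftU (θ : ℕ → Ty) : TVar → Ty
  | .u α => θ α
  | .e a => .evar a

/-- `θ` unifies `s` and `t`. -/
def Unifies (θ : ℕ → Ty) (s t : Ty) : Prop := s.subst (liftU θ) = t.subst (liftU θ)

/-- `θ = mgu(s, t)`: `θ` is an (idempotent) most general unifier of `s` and `t`. -/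
structure IsMGU (θ : ℕ → Ty) (s t : Ty) : Prop where
  unifies : Unifies θ s t
  general : ∀ θ' : ℕ → Ty, Unifies θ' s t → ∃ ρ : ℕ → Ty, ∀ α, θ' α = (θ α).subst (liftU ρ)
  idem : ∀ α, (θ α).subst (liftU θ) = θ α

/-- `mgu(s, t) = ⊥`: there is no unifier. -/
def NotUnifiable (s t : Ty) : Prop := ¬ ∃ θ : ℕ → Ty, Unifies θ s t

/-! ## Pattern expansion -/

/-- `ρ ∈ {z, _}`: a variable or wildcard pattern. -/
inductive Pat.IsVarOrWild : Pat → Prop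
  | var (z : ℕ) : Pat.IsVarOrWild (.var z)
  | wild : Pat.IsVarOrWild .wild

/-- `Π ⇝× Π'`. -/
inductive ExpandPair : Branches → Branches → Prop
  | nil : ExpandPair .nil .nil
  | pair {ρ₁ ρ₂ : Pat} {ρs : List Pat} {e : Exp} {B B' : Branches} :
      ExpandPair B B' →
      ExpandPair (.cons (.pair ρ₁ ρ₂ :: ρs) e B) (.cons (ρ₁ :: ρ₂ :: ρs) e B')
  | var {ρ : Pat} {ρs : List Pat} {e : Exp} {B B' : Branches} :
      ρ.IsVarOrWild → ExpandPair B B' →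
      ExpandPair (.cons (ρ :: ρs) e B) (.cons (.wild :: .wild :: ρs) e B')

/-- `Π ⇝+ Π_L ‖ Π_R`. -/
inductive ExpandSum : Branches → Branches → Branches → Prop
  | nil : ExpandSum .nil .nil .nil
  | inj₁ {ρ : Pat} {ρs : List Pat} {e : Exp} {B BL BR : Branches} :
      ExpandSum B BL BR → ExpandSum (.cons (.inj₁ ρ :: ρs) e B) (.cons (ρ :: ρs) e BL) BR
  | inj₂ {ρ : Pat} {ρs : List Pat} {e : Exp} {B BL BR : Branches} :
      ExpandSum B BL BR → ExpandSum (.cons (.inj₂ ρ :: ρs) e B) BL (.cons (ρ :: ρs) e BR)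
  | var {ρ : Pat} {ρs : List Pat} {e : Exp} {B BL BR : Branches} :
      ρ.IsVarOrWild → ExpandSum B BL BR →
      ExpandSum (.cons (ρ :: ρs) e B) (.cons (.wild :: ρs) e BL) (.cons (.wild :: ρs) e BR)

/-- `Π ⇝var Π'`. -/
inductive ExpandVar : Branches → Branches → Prop
  | nil : ExpandVar .nil .nil
  | var {ρ : Pat} {ρs : List Pat} {e : Exp} {B B' : Branches} :
      ρ.IsVarOrWild → ExpandVar B B' → ExpandVar (.cons (ρ :: ρs) e B) (.cons ρs e B')

/-- `Π ⇝1 Π'`. -/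
inductive ExpandUnit : Branches → Branches → Prop
  | nil : ExpandUnit .nil .nil
  | unit {ρs : List Pat} {e : Exp} {B B' : Branches} :
      ExpandUnit B B' → ExpandUnit (.cons (.unit :: ρs) e B) (.cons ρs e B')
  | var {ρ : Pat} {ρs : List Pat} {e : Exp} {B B' : Branches} :
      ρ.IsVarOrWild → ExpandUnit B B' → ExpandUnit (.cons (ρ :: ρs) e B) (.cons ρs e B')

/-- `Π ⇝Vec Π_[] ‖ Π_∷`. -/
inductive ExpandVec : Branches → Branches → Branches → Prop
  | nil : ExpandVec .nil .nil .nil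
  | empty {ρs : List Pat} {e : Exp} {B BN BC : Branches} :
      ExpandVec B BN BC → ExpandVec (.cons (.nil :: ρs) e B) (.cons ρs e BN) BC
  | cons {ρ₁ ρ₂ : Pat} {ρs : List Pat} {e : Exp} {B BN BC : Branches} :
      ExpandVec B BN BC →
      ExpandVec (.cons (.cons ρ₁ ρ₂ :: ρs) e B) BN (.cons (ρ₁ :: ρ₂ :: ρs) e BC)
  | var {ρ : Pat} {ρs : List Pat} {e : Exp} {B BN BC : Branches} :
      ρ.IsVarOrWild → ExpandVec B BN BC →
      ExpandVec (.cons (ρ :: ρs) e B) (.cons ρs e BN) (.cons (.wild :: .wild :: ρs) e BC)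

/-! ## Match coverage

The fresh variables of the rules for `∃` and `Vec` range over all but finitely many names. -/

mutual
/-- Declarative coverage `Ψ ⊢ Π covers A⃗`. -/
inductive DeclCovers : DCtx → Branches → List Ty → Prop
  | empty {Ψ : DCtx} {e : Exp} {B : Branches} : DeclCovers Ψ (.cons [] e B) []
  | var {Ψ : DCtx} {B B' : Branches} {A : Ty} {As : List Ty} :
      ExpandVar B B' → DeclCovers Ψ B' As → DeclCovers Ψ B (A :: As)
  | unit {Ψ : DCtx} {B B' : Branches} {As : List Ty} :
      ExpandUnit B B' → DeclCovers Ψ B' As → DeclCovers Ψ B (.one :: As)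
  | times {Ψ : DCtx} {B B' : Branches} {A₁ A₂ : Ty} {As : List Ty} :
      ExpandPair B B' → DeclCovers Ψ B' (A₁ :: A₂ :: As) →
      DeclCovers Ψ B (.bin .prod A₁ A₂ :: As)
  | sum {Ψ : DCtx} {B BL BR : Branches} {A₁ A₂ : Ty} {As : List Ty} :
      ExpandSum B BL BR → DeclCovers Ψ BL (A₁ :: As) → DeclCovers Ψ BR (A₂ :: As) →
      DeclCovers Ψ B (.bin .sum A₁ A₂ :: As)
  | ex {Ψ : DCtx} {B : Branches} {κ : Sort'} {A : Ty} {As : List Ty} (L : Finset ℕ) :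
      (∀ α, α ∉ L → DeclCovers (.decl α κ :: Ψ) B (A.openU α :: As)) →
      DeclCovers Ψ B (.ex κ A :: As)
  | wth {Ψ : DCtx} {B : Branches} {A s t : Ty} {As : List Ty} :
      DeclCoversEq Ψ ⟨s, t⟩ B (A :: As) → DeclCovers Ψ B (.wth A s t :: As)
  | vec {Ψ : DCtx} {B BN BC : Branches} {t A : Ty} {As : List Ty} (L : Finset ℕ) :
      ExpandVec B BN BC →
      DeclCoversEq Ψ ⟨t, .zero⟩ BN As →
      (∀ n, n ∉ L → DeclCoversEq (.decl n .nat :: Ψ) ⟨t, .succ (.uvar n)⟩ BC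
        (A :: .vec (.uvar n) A :: As)) →
      DeclCovers Ψ B (.vec t A :: As)
/-- Declarative coverage under an assumed equation, `Ψ / P ⊢ Π covers A⃗`. -/
inductive DeclCoversEq : DCtx → Prp → Branches → List Ty → Prop
  | eq {Ψ : DCtx} {t₁ t₂ : Ty} {B : Branches} {As : List Ty} {θ : ℕ → Ty} :
      IsMGU θ t₁ t₂ →
      DeclCovers (Ψ.subst (liftU θ)) (B.subst (liftU θ)) (As.map (Ty.subst (liftU θ))) →
      DeclCoversEq Ψ ⟨t₁, t₂⟩ B As
  | eqBot {Ψ : DCtx} {t₁ t₂ : Ty} {B : Branches} {As : List Ty} :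
      NotUnifiable t₁ t₂ → DeclCoversEq Ψ ⟨t₁, t₂⟩ B As
end

mutual
/-- Algorithmic coverage `Γ ⊢ Π covers A⃗`. -/
inductive Covers : Ctx → Branches → List Ty → Prop
  | empty {Γ : Ctx} {e : Exp} {B : Branches} : Covers Γ (.cons [] e B) []
  | var {Γ : Ctx} {B B' : Branches} {A : Ty} {As : List Ty} :
      ExpandVar B B' → Covers Γ B' As → Covers Γ B (A :: As)
  | unit {Γ : Ctx} {B B' : Branches} {As : List Ty} :
      ExpandUnit B B' → Covers Γ B' As → Covers Γ B (.one :: As)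
  | times {Γ : Ctx} {B B' : Branches} {A₁ A₂ : Ty} {As : List Ty} :
      ExpandPair B B' → Covers Γ B' (A₁ :: A₂ :: As) → Covers Γ B (.bin .prod A₁ A₂ :: As)
  | sum {Γ : Ctx} {B BL BR : Branches} {A₁ A₂ : Ty} {As : List Ty} :
      ExpandSum B BL BR → Covers Γ BL (A₁ :: As) → Covers Γ BR (A₂ :: As) →
      Covers Γ B (.bin .sum A₁ A₂ :: As)
  | ex {Γ : Ctx} {B : Branches} {κ : Sort'} {A : Ty} {As : List Ty} (L : Finset ℕ) :
      (∀ α, α ∉ L → Covers (.decl (.u α) κ :: Γ) B (A.openU α :: As)) →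
      Covers Γ B (.ex κ A :: As)
  | wth {Γ : Ctx} {B : Branches} {A s t : Ty} {As : List Ty} :
      CoversEq Γ ⟨s, t⟩ B (A :: As) → Covers Γ B (.wth A s t :: As)
  | vec {Γ : Ctx} {B BN BC : Branches} {t A : Ty} {As : List Ty} (L : Finset ℕ) :
      ExpandVec B BN BC →
      CoversEq Γ ⟨t, .zero⟩ BN As →
      (∀ n, n ∉ L → CoversEq (.decl (.u n) .nat :: Γ) ⟨t, .succ (.uvar n)⟩ BC
        (A :: .vec (.uvar n) A :: As)) →
      Covers Γ B (.vec t A :: As)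
/-- Algorithmic coverage under an assumed equation, `Γ / P ⊢ Π covers A⃗`. -/
inductive CoversEq : Ctx → Prp → Branches → List Ty → Prop
  | eq {Γ Δ : Ctx} {t₁ t₂ : Ty} {κ : Sort'} {B : Branches} {As : List Ty} :
      ElimEq Γ (t₁.subst (ctxSubst Γ)) (t₂.subst (ctxSubst Γ)) κ (some Δ) →
      Covers Δ (B.subst (ctxSubst Δ)) (As.map (Ty.subst (ctxSubst Δ))) →
      CoversEq Γ ⟨t₁, t₂⟩ B As
  | eqBot {Γ : Ctx} {t₁ t₂ : Ty} {κ : Sort'} {B : Branches} {As : List Ty} :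
      ElimEq Γ (t₁.subst (ctxSubst Γ)) (t₂.subst (ctxSubst Γ)) κ none →
      CoversEq Γ ⟨t₁, t₂⟩ B As
end

end Bidir

open Bidir

namespace Bidir

/-! ## Substitution and free variables -/

theorem Ty.subst_eq_self_iff {σ : TVar → Ty} {A : Ty} :
    A.subst σ = A ↔ ∀ v ∈ A.fv, σ v = .fvar v := by
  induction A <;> simp_all [Ty.subst, Ty.fv, or_imp, forall_and]

theorem Ty.subst_subst (σ τ : TVar → Ty) (A : Ty) :
    (A.subst σ).subst τ = A.subst fun v => (σ v).subst τ := by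
  induction A <;> simp_all [Ty.subst]

theorem Ty.fv_subst_subset {σ : TVar → Ty} {A : Ty} {S : Finset TVar}
    (h : ∀ v ∈ A.fv, (σ v).fv ⊆ S) : (A.subst σ).fv ⊆ S := by
  induction A <;>
    simp_all [Ty.subst, Ty.fv, or_imp, forall_and, Finset.union_subset_iff]

theorem Ty.fv_openAt_subset (B A : Ty) (k : ℕ) : (openAt B k A).fv ⊆ A.fv ∪ B.fv := by
  induction A generalizing k with
  | bvar i => by_cases h : i = k <;> simp [openAt, fv, h]
  | fvar | zero | one => simp [openAt, fv]
  | succ t ih => simpa [openAt, fv] using ih k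
  | all κ A ih | ex κ A ih => simpa [openAt, fv] using ih (k + 1)
  | bin _ A C ihA ihC | vec A C ihA ihC =>
    have hA := ihA k
    have hC := ihC k
    simp only [openAt, fv]
    grind
  | imp A C D ihA ihC ihD | wth A C D ihA ihC ihD =>
    have hA := ihA k
    have hC := ihC k
    have hD := ihD k
    simp only [openAt, fv]
    grind

theorem Ty.subst_openU_eq_self {σ : TVar → Ty} {A : Ty} {α : ℕ}
    (hA : A.subst σ = A) (hα : σ (.u α) = uvar α) : (A.openU α).subst σ = A.openU α := by
  rw [subst_eq_self_iff] at hA ⊢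
  intro v hv
  rcases Finset.mem_union.1 (fv_openAt_subset _ _ _ hv) with h | h
  · exact hA v h
  · obtain rfl : v = .u α := by simpa [fv] using h
    exact hα

/-- The number of constructors of a type. -/
def Ty.size : Ty → ℕ
  | bvar _ => 1
  | fvar _ => 1
  | zero => 1
  | succ t => size t + 1
  | one => 1
  | bin _ A B => size A + size B + 1
  | vec t A => size t + size A + 1
  | all _ A => size A + 1
  | ex _ A => size A + 1
  | imp s t A => size s + size t + size A + 1
  | wth A s t => size A + size s + size t + 1

theorem Ty.size_le_size_subst {σ : TVar → Ty} {A : Ty} {v : TVar} (hv : v ∈ A.fv) :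
    (σ v).size ≤ (A.subst σ).size := by
  induction A <;> simp only [fv, Finset.mem_union, Finset.mem_singleton,
    Finset.notMem_empty] at hv <;> grind [Ty.subst, Ty.size]

theorem Ty.size_lt_size_subst {σ : TVar → Ty} {A : Ty} {v : TVar} (hv : v ∈ A.fv)
    (hne : A ≠ .fvar v) : (σ v).size < (A.subst σ).size := by
  cases A <;> simp only [fv, Finset.mem_union, Finset.mem_singleton,
    Finset.notMem_empty] at hv <;> grind [Ty.subst, Ty.size, Ty.size_le_size_subst]

theorem ctxSubst_uvar_eq_self {Γ : Ctx} {α : ℕ} (h : ¬ HasEqn α Γ) :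
    ctxSubst Γ (.u α) = .uvar α := by
  induction Γ with
  | nil => rfl
  | cons E Γ ih =>
    have hΓ : ¬ HasEqn α Γ := fun ⟨τ, hτ⟩ => h ⟨τ, List.mem_cons_of_mem _ hτ⟩
    cases E with
    | eqn β τ =>
      have hβ : α ≠ β := by
        rintro rfl
        exact h ⟨τ, List.mem_cons_self⟩
      simp [ctxSubst, ih hΓ, Ty.subst, single, hβ]
    | solved => simp [ctxSubst, ih hΓ, Ty.subst, single]
    | _ => exact ih hΓ

theorem exists_finset_hasEqn (Γ : Ctx) : ∃ L : Finset ℕ, ∀ α ∉ L, ¬ HasEqn α Γ := by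
  induction Γ with
  | nil => exact ⟨∅, fun α _ ⟨τ, hτ⟩ => by simp at hτ⟩
  | cons E Γ ih =>
    obtain ⟨L, hL⟩ := ih
    cases E with
    | eqn β τ =>
      refine ⟨insert β L, fun α hα ⟨τ', hτ'⟩ => ?_⟩
      rw [Finset.mem_insert, not_or] at hα
      rcases List.mem_cons.1 hτ' with h | h
      · injection h with h _
        exact hα.1 h
      · exact hL α hα.2 ⟨τ', h⟩
    | _ => exact ⟨L, fun α hα ⟨τ', hτ'⟩ => hL α hα ⟨τ', by simpa using hτ'⟩⟩

/-! ## Context application is defined along extensions -/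

theorem inDom_cons {v : TVar} {E : Entry} {Γ : Ctx} :
    InDom v (E :: Γ) ↔
      (∃ κ, E = .decl v κ) ∨ (∃ a κ τ, v = .e a ∧ E = .solved a κ τ) ∨ InDom v Γ := by
  simp only [InDom, List.mem_cons]
  grind

theorem Extends.inDom {Γ Δ : Ctx} (h : Extends Γ Δ) {v : TVar} (hv : InDom v Γ) :
    InDom v Δ := by
  induction h with
  | id => exact hv
  | _ => simp only [inDom_cons, Entry.decl.injEq, Entry.solved.injEq, reduceCtorEq] at *; grind

theorem ctxApply_solved_of_not_inDom {Ω Γ : Ctx} {a : ℕ} {κ : Sort'} {t : Ty}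
    (h : ¬ InDom (.e a) Γ) : ctxApply (.solved a κ t :: Ω) Γ = ctxApply Ω Γ := by
  rw [ctxApply.eq_def]
  simp [h]

theorem Extends.exists_ctxApply {Γ Ω : Ctx} (h : Extends Γ Ω) (hΩ : WF Ω) (hc : Complete Ω) :
    ∃ Ψ, ctxApply Ω Γ = some Ψ := by
  have tail {E : Entry} {Ω : Ctx} (hc : Complete (E :: Ω)) : Complete Ω :=
    fun a κ ha => hc a κ (List.mem_cons_of_mem _ ha)
  induction h with
  | id => exact ⟨[], by simp [ctxApply]⟩
  | hyp h he ih =>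
    cases hΩ with
    | hyp hΩ =>
      obtain ⟨Ψ, hΨ⟩ := ih hΩ (tail hc)
      simp [ctxApply, he, hΨ]
  | uvar h ih =>
    cases hΩ with
    | decl hΩ =>
      obtain ⟨Ψ, hΨ⟩ := ih hΩ (tail hc)
      simp [ctxApply, hΨ]
  | evar h ih => exact absurd List.mem_cons_self (hc _ _)
  | solved h he ih =>
    cases hΩ with
    | solved hΩ =>
      obtain ⟨Ψ, hΨ⟩ := ih hΩ (tail hc)
      refine ⟨Ψ, ?_⟩
      simp [ctxApply, inDom_cons, he, hΨ]
  | solve h ih =>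
    cases hΩ with
    | solved hΩ =>
      obtain ⟨Ψ, hΨ⟩ := ih hΩ (tail hc)
      refine ⟨Ψ, ?_⟩
      simp [ctxApply, inDom_cons, hΨ]
  | eqn h he ih =>
    cases hΩ with
    | eqn hΩ =>
      obtain ⟨Ψ, hΨ⟩ := ih hΩ (tail hc)
      simp [ctxApply, he, hΨ]
  | marker h ih =>
    cases hΩ with
    | marker hΩ =>
      obtain ⟨Ψ, hΨ⟩ := ih hΩ (tail hc)
      simp [ctxApply, hΨ]
  | add h ih => exact absurd List.mem_cons_self (hc _ _)
  | addSolved h ih =>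
    cases hΩ with
    | solved hΩ hd =>
      obtain ⟨Ψ, hΨ⟩ := ih hΩ (tail hc)
      exact ⟨Ψ, by rw [ctxApply_solved_of_not_inDom fun hv => hd (h.inDom hv), hΨ]⟩

/-! ## Equality elimination computes most general unifiers -/

/-- `θ` unifies `s` and `t`, is absorbed by every unifier, and introduces only variables
of `s` and `t`. -/
structure AbsorbedUnifier (θ : ℕ → Ty) (s t : Ty) : Prop where
  unifies : Unifies θ s t
  absorbed : ∀ θ' : ℕ → Ty, Unifies θ' s t → ∀ α, (θ α).subst (liftU θ') = θ' α
  fv_subset : ∀ α, (θ α).fv ⊆ insert (.u α) (s.fv ∪ t.fv)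

theorem subst_liftU_comp (θ₁ θ₂ : ℕ → Ty) (A : Ty) :
    A.subst (liftU fun α => (θ₁ α).subst (liftU θ₂)) =
      (A.subst (liftU θ₁)).subst (liftU θ₂) := by
  rw [Ty.subst_subst]
  congr 1
  funext v
  cases v <;> rfl

theorem subst_liftU_uvar (A : Ty) : A.subst (liftU Ty.uvar) = A :=
  Ty.subst_eq_self_iff.2 fun v _ => by cases v <;> rfl

theorem AbsorbedUnifier.isMGU {θ : ℕ → Ty} {s t : Ty} (h : AbsorbedUnifier θ s t) :
    IsMGU θ s t :=
  ⟨h.unifies, fun θ' hθ' => ⟨θ', fun α => (h.absorbed θ' hθ' α).symm⟩,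
    h.absorbed θ h.unifies⟩

theorem AbsorbedUnifier.subst_absorbed {θ θ' : ℕ → Ty} {s t : Ty} (h : AbsorbedUnifier θ s t)
    (hθ' : Unifies θ' s t) (A : Ty) :
    (A.subst (liftU θ)).subst (liftU θ') = A.subst (liftU θ') := by
  rw [← subst_liftU_comp, funext (h.absorbed θ' hθ')]

theorem AbsorbedUnifier.fv_subst_subset {θ : ℕ → Ty} {s t A : Ty} {S : Finset TVar}
    (h : AbsorbedUnifier θ s t) (hs : s.fv ⊆ S) (ht : t.fv ⊆ S) (hA : A.fv ⊆ S) :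
    (A.subst (liftU θ)).fv ⊆ S := by
  refine Ty.fv_subst_subset fun v hv => ?_
  cases v with
  | u α =>
    exact (h.fv_subset α).trans
      (Finset.insert_subset (hA hv) (Finset.union_subset hs ht))
  | e a => simpa [liftU, Ty.fv] using hA hv

theorem AbsorbedUnifier.refl (t : Ty) : AbsorbedUnifier Ty.uvar t t :=
  ⟨rfl, fun _ _ _ => rfl, fun α => by simp [Ty.fv]⟩

theorem AbsorbedUnifier.symm {θ : ℕ → Ty} {s t : Ty} (h : AbsorbedUnifier θ s t) :
    AbsorbedUnifier θ t s :=
  ⟨h.unifies.symm, fun θ' hθ' => h.absorbed θ' hθ'.symm, fun α => by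
    rw [Finset.union_comm]; exact h.fv_subset α⟩

theorem AbsorbedUnifier.succ {θ : ℕ → Ty} {s t : Ty} (h : AbsorbedUnifier θ s t) :
    AbsorbedUnifier θ (.succ s) (.succ t) :=
  ⟨congrArg Ty.succ h.unifies,
    fun θ' hθ' => h.absorbed θ' (by simpa [Unifies, Ty.subst] using hθ'), h.fv_subset⟩

theorem liftU_update_uvar (α : ℕ) (t : Ty) :
    liftU (Function.update Ty.uvar α t) = single (.u α) t := by
  funext v
  cases v with
  | u β => by_cases h : β = α <;> simp [liftU, single, h]
  | e a => simp [liftU, single]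

theorem AbsorbedUnifier.update {α : ℕ} {t : Ty} (h : TVar.u α ∉ t.fv) :
    AbsorbedUnifier (Function.update Ty.uvar α t) (.uvar α) t where
  unifies := by
    rw [Unifies, liftU_update_uvar, (Ty.subst_eq_self_iff (A := t)).2]
    · simp [Ty.subst, single]
    · intro v hv
      have : v ≠ .u α := by rintro rfl; exact h hv
      simp [single, this]
  absorbed θ' hθ' β := by
    by_cases hβ : β = α
    · subst hβ
      simpa [Unifies, Ty.subst, liftU] using hθ'.symm
    · simp [hβ, Ty.subst, liftU]
  fv_subset β := by
    by_cases hβ : β = α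
    · subst hβ
      simp only [Function.update_self, Ty.fv]
      grind
    · simp [hβ, Ty.fv]

theorem AbsorbedUnifier.bin {θ₁ θ₂ : ℕ → Ty} {op : BinOp} {σ₁ σ₂ τ₁ τ₂ : Ty}
    (h₁ : AbsorbedUnifier θ₁ σ₁ τ₁)
    (h₂ : AbsorbedUnifier θ₂ (σ₂.subst (liftU θ₁)) (τ₂.subst (liftU θ₁))) :
    AbsorbedUnifier (fun α => (θ₁ α).subst (liftU θ₂)) (.bin op σ₁ σ₂) (.bin op τ₁ τ₂) where
  unifies := by
    have e₁ := h₁.unifies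
    have e₂ := h₂.unifies
    simp only [Unifies] at e₁ e₂ ⊢
    simp only [Ty.subst, subst_liftU_comp, e₁, e₂]
  absorbed θ' hθ' α := by
    simp only [Unifies, Ty.subst, Ty.bin.injEq, true_and] at hθ'
    have hθ₂ : Unifies θ' (σ₂.subst (liftU θ₁)) (τ₂.subst (liftU θ₁)) := by
      rw [Unifies, h₁.subst_absorbed hθ'.1, h₁.subst_absorbed hθ'.1, hθ'.2]
    rw [h₂.subst_absorbed hθ₂, h₁.absorbed θ' hθ'.1]
  fv_subset α := by
    have hfv {A : Ty} (hA : A.fv ⊆ insert (.u α)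
        ((Ty.bin op σ₁ σ₂).fv ∪ (Ty.bin op τ₁ τ₂).fv)) :=
      h₁.fv_subst_subset (S := insert (.u α) ((Ty.bin op σ₁ σ₂).fv ∪ (Ty.bin op τ₁ τ₂).fv))
        (by simp only [Ty.fv]; grind) (by simp only [Ty.fv]; grind) hA
    refine h₂.fv_subst_subset (hfv ?_) (hfv ?_) (hfv (A := .uvar α) ?_) <;>
      simp only [Ty.fv] <;> grind

theorem Clash.notUnifiable {s t : Ty} (h : Clash s t) : NotUnifiable s t := by
  rintro ⟨θ, hθ⟩
  cases h <;> simp_all [Unifies, Ty.subst]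

theorem notUnifiable_of_occurs {α : ℕ} {t : Ty} (hne : t ≠ .uvar α) (h : TVar.u α ∈ t.fv) :
    NotUnifiable (.uvar α) t := by
  rintro ⟨θ, hθ⟩
  have := Ty.size_lt_size_subst (σ := liftU θ) h hne
  rw [← hθ] at this
  exact lt_irrefl _ this

theorem NotUnifiable.symm {s t : Ty} (h : NotUnifiable s t) : NotUnifiable t s :=
  fun ⟨θ, hθ⟩ => h ⟨θ, hθ.symm⟩

/-- What the output of equality elimination means for the eliminated equation. -/
def ElimSound (Γ : Ctx) (s t : Ty) : Option Ctx → Prop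
  | none => NotUnifiable s t
  | some Δ => ∃ θ : ℕ → Ty, AbsorbedUnifier θ s t ∧
      ∀ A : Ty, A.subst (ctxSubst Δ) = (A.subst (ctxSubst Γ)).subst (liftU θ)

theorem AbsorbedUnifier.subst_ctxSubst_idem {Γ Δ : Ctx} {θ : ℕ → Ty} {s t A : Ty}
    (h : AbsorbedUnifier θ s t)
    (hΔ : ∀ A : Ty, A.subst (ctxSubst Δ) = (A.subst (ctxSubst Γ)).subst (liftU θ))
    (hs : s.subst (ctxSubst Γ) = s) (ht : t.subst (ctxSubst Γ) = t)
    (hA : A.subst (ctxSubst Γ) = A) :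
    (A.subst (ctxSubst Δ)).subst (ctxSubst Δ) = A.subst (ctxSubst Δ) := by
  have hθA : (A.subst (liftU θ)).subst (ctxSubst Γ) = A.subst (liftU θ) := by
    rw [Ty.subst_eq_self_iff] at hs ht hA ⊢
    intro v hv
    have hv' := h.fv_subst_subset (S := s.fv ∪ t.fv ∪ A.fv) (by grind) (by grind) (by grind) hv
    simp only [Finset.mem_union] at hv'
    rcases hv' with (hv' | hv') | hv'
    exacts [hs v hv', ht v hv', hA v hv']
  rw [hΔ A, hA, hΔ, hθA, h.subst_absorbed h.unifies]

theorem subst_ctxSubst_eqn {Γ : Ctx} {α : ℕ} {t : Ty} (ht : t.subst (ctxSubst Γ) = t) (A : Ty) :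
    A.subst (ctxSubst (.eqn α t :: Γ)) =
      (A.subst (ctxSubst Γ)).subst (liftU (Function.update Ty.uvar α t)) := by
  rw [liftU_update_uvar, Ty.subst_subst]
  simp only [ctxSubst, ht]

theorem ElimEq.sound {Γ : Ctx} {s t : Ty} {κ : Sort'} {D : Option Ctx} (h : ElimEq Γ s t κ D)
    (hs : s.subst (ctxSubst Γ) = s) (ht : t.subst (ctxSubst Γ) = t) : ElimSound Γ s t D := by
  induction h with
  | uvarRefl | zero | unit => exact ⟨Ty.uvar, .refl _, fun A => (subst_liftU_uvar _).symm⟩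
  | @succ Γ s t D _ ih =>
    simp only [Ty.subst, Ty.succ.injEq] at hs ht
    have := ih hs ht
    cases D with
    | none => exact fun ⟨θ, hθ⟩ => this ⟨θ, by simpa [Unifies, Ty.subst] using hθ⟩
    | some Δ =>
      obtain ⟨θ, hθ, hΔ⟩ := this
      exact ⟨θ, hθ.succ, hΔ⟩
  | uvarL hα => exact ⟨_, .update hα, subst_ctxSubst_eqn ht⟩
  | uvarR hα => exact ⟨_, (AbsorbedUnifier.update hα).symm, subst_ctxSubst_eqn hs⟩
  | uvarLBot hne hα => exact notUnifiable_of_occurs hne hα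
  | uvarRBot hne hα => exact (notUnifiable_of_occurs hne hα).symm
  | @bin Γ Θ op σ₁ σ₂ τ₁ τ₂ D _ _ ih₁ ih₂ =>
    simp only [Ty.subst, Ty.bin.injEq, true_and] at hs ht
    obtain ⟨θ₁, hθ₁, hΘ⟩ := ih₁ hs.1 ht.1
    have := ih₂ (hθ₁.subst_ctxSubst_idem hΘ hs.1 ht.1 hs.2)
      (hθ₁.subst_ctxSubst_idem hΘ hs.1 ht.1 ht.2)
    rw [hΘ, hΘ, hs.2, ht.2] at this
    cases D with
    | none =>
      rintro ⟨θ', hθ'⟩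
      simp only [Unifies, Ty.subst, Ty.bin.injEq, true_and] at hθ'
      refine this ⟨θ', ?_⟩
      rw [Unifies, hθ₁.subst_absorbed hθ'.1, hθ₁.subst_absorbed hθ'.1, hθ'.2]
    | some Δ =>
      obtain ⟨θ₂, hθ₂, hΔ⟩ := this
      exact ⟨_, hθ₁.bin hθ₂, fun A => by rw [hΔ, hΘ, subst_liftU_comp]⟩
  | binBot _ ih =>
    simp only [Ty.subst, Ty.bin.injEq, true_and] at hs ht
    rintro ⟨θ', hθ'⟩
    simp only [Unifies, Ty.subst, Ty.bin.injEq, true_and] at hθ'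
    exact ih hs.1 ht.1 ⟨θ', hθ'.1⟩
  | clash h => exact h.notUnifiable

/-! ## Coverage depends only on the patterns of the branches -/

/-- Two branch lists with the same patterns. -/
inductive SamePats : Branches → Branches → Prop
  | nil : SamePats .nil .nil
  | cons {ρs : List Pat} {e e' : Exp} {B C : Branches} :
      SamePats B C → SamePats (.cons ρs e B) (.cons ρs e' C)

theorem SamePats.refl : ∀ B : Branches, SamePats B B
  | .nil => .nil
  | .cons _ _ B => .cons (refl B)

theorem SamePats.subst_subst (σ τ : TVar → Ty) {B C : Branches} (h : SamePats B C) :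
    SamePats (B.subst σ) (C.subst τ) := by
  induction h with
  | nil => simpa [Branches.subst] using SamePats.nil
  | cons _ ih => simpa [Branches.subst] using SamePats.cons ih

theorem ExpandVar.samePats {B B' C : Branches} (h : ExpandVar B B') (hC : SamePats B C) :
    ∃ C', ExpandVar C C' ∧ SamePats B' C' := by
  induction h generalizing C with
  | nil => cases hC; exact ⟨_, .nil, .nil⟩
  | var hρ _ ih =>
    cases hC with | cons hC =>
    obtain ⟨C', h, h'⟩ := ih hC
    exact ⟨_, .var hρ h, .cons h'⟩

theorem ExpandUnit.samePats {B B' C : Branches} (h : ExpandUnit B B') (hC : SamePats B C) :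
    ∃ C', ExpandUnit C C' ∧ SamePats B' C' := by
  induction h generalizing C with
  | nil => cases hC; exact ⟨_, .nil, .nil⟩
  | unit _ ih =>
    cases hC with | cons hC =>
    obtain ⟨C', h, h'⟩ := ih hC
    exact ⟨_, .unit h, .cons h'⟩
  | var hρ _ ih =>
    cases hC with | cons hC =>
    obtain ⟨C', h, h'⟩ := ih hC
    exact ⟨_, .var hρ h, .cons h'⟩

theorem ExpandPair.samePats {B B' C : Branches} (h : ExpandPair B B') (hC : SamePats B C) :
    ∃ C', ExpandPair C C' ∧ SamePats B' C' := by
  induction h generalizing C with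
  | nil => cases hC; exact ⟨_, .nil, .nil⟩
  | pair _ ih =>
    cases hC with | cons hC =>
    obtain ⟨C', h, h'⟩ := ih hC
    exact ⟨_, .pair h, .cons h'⟩
  | var hρ _ ih =>
    cases hC with | cons hC =>
    obtain ⟨C', h, h'⟩ := ih hC
    exact ⟨_, .var hρ h, .cons h'⟩

theorem ExpandSum.samePats {B BL BR C : Branches} (h : ExpandSum B BL BR)
    (hC : SamePats B C) :
    ∃ CL CR, ExpandSum C CL CR ∧ SamePats BL CL ∧ SamePats BR CR := by
  induction h generalizing C with
  | nil => cases hC; exact ⟨_, _, .nil, .nil, .nil⟩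
  | inj₁ _ ih =>
    cases hC with | cons hC =>
    obtain ⟨CL, CR, h, hL, hR⟩ := ih hC
    exact ⟨_, _, .inj₁ h, .cons hL, hR⟩
  | inj₂ _ ih =>
    cases hC with | cons hC =>
    obtain ⟨CL, CR, h, hL, hR⟩ := ih hC
    exact ⟨_, _, .inj₂ h, hL, .cons hR⟩
  | var hρ _ ih =>
    cases hC with | cons hC =>
    obtain ⟨CL, CR, h, hL, hR⟩ := ih hC
    exact ⟨_, _, .var hρ h, .cons hL, .cons hR⟩

theorem ExpandVec.samePats {B BN BC C : Branches} (h : ExpandVec B BN BC)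
    (hC : SamePats B C) :
    ∃ CN CC, ExpandVec C CN CC ∧ SamePats BN CN ∧ SamePats BC CC := by
  induction h generalizing C with
  | nil => cases hC; exact ⟨_, _, .nil, .nil, .nil⟩
  | empty _ ih =>
    cases hC with | cons hC =>
    obtain ⟨CN, CC, h, hN, hCC⟩ := ih hC
    exact ⟨_, _, .empty h, .cons hN, hCC⟩
  | cons _ ih =>
    cases hC with | cons hC =>
    obtain ⟨CN, CC, h, hN, hCC⟩ := ih hC
    exact ⟨_, _, .cons h, hN, .cons hCC⟩
  | var hρ _ ih =>
    cases hC with | cons hC =>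
    obtain ⟨CN, CC, h, hN, hCC⟩ := ih hC
    exact ⟨_, _, .var hρ h, .cons hN, .cons hCC⟩

/-! ## Soundness of coverage -/

mutual

theorem Covers.sound {Γ : Ctx} {B : Branches} {As : List Ty} (h : Covers Γ B As)
    (hAs : ∀ A ∈ As, A.subst (ctxSubst Γ) = A) {C : Branches} (hC : SamePats B C) (Ψ : DCtx) :
    DeclCovers Ψ C As := by
  match h with
  | .empty => cases hC; exact .empty
  | .var hB h =>
    obtain ⟨C', hC', h'⟩ := hB.samePats hC
    exact .var hC' (h.sound (List.forall_mem_cons.1 hAs).2 h' Ψ)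
  | .unit hB h =>
    obtain ⟨C', hC', h'⟩ := hB.samePats hC
    exact .unit hC' (h.sound (List.forall_mem_cons.1 hAs).2 h' Ψ)
  | .times hB h =>
    obtain ⟨C', hC', h'⟩ := hB.samePats hC
    simp only [List.forall_mem_cons, Ty.subst, Ty.bin.injEq, true_and] at hAs
    exact .times hC' (h.sound (by simpa [and_assoc] using hAs) h' Ψ)
  | .sum hB hL hR =>
    obtain ⟨CL, CR, hC', hCL, hCR⟩ := hB.samePats hC
    simp only [List.forall_mem_cons, Ty.subst, Ty.bin.injEq, true_and] at hAs
    exact .sum hC' (hL.sound (List.forall_mem_cons.2 ⟨hAs.1.1, hAs.2⟩) hCL Ψ)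
      (hR.sound (List.forall_mem_cons.2 ⟨hAs.1.2, hAs.2⟩) hCR Ψ)
  | .ex L h =>
    obtain ⟨L', hL'⟩ := exists_finset_hasEqn Γ
    simp only [List.forall_mem_cons, Ty.subst, Ty.ex.injEq, true_and] at hAs
    refine .ex (L ∪ L') fun α hα => ?_
    rw [Finset.mem_union, not_or] at hα
    exact (h α hα.1).sound (List.forall_mem_cons.2
      ⟨Ty.subst_openU_eq_self hAs.1 (ctxSubst_uvar_eq_self (Γ := Γ) (hL' α hα.2)), hAs.2⟩) hC _
  | .wth h =>
    simp only [List.forall_mem_cons, Ty.subst, Ty.wth.injEq] at hAs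
    exact .wth (h.sound (by simp only [Prp.subst, hAs.1.2]) (List.forall_mem_cons.2 ⟨hAs.1.1, hAs.2⟩) hC Ψ)
  | .vec L hB hN hCons =>
    obtain ⟨CN, CC, hC', hCN, hCC⟩ := hB.samePats hC
    obtain ⟨L', hL'⟩ := exists_finset_hasEqn Γ
    simp only [List.forall_mem_cons, Ty.subst, Ty.vec.injEq] at hAs
    refine .vec (L ∪ L') hC' (hN.sound (by simp only [Prp.subst, Ty.subst, hAs.1.1]) hAs.2 hCN Ψ) fun n hn => ?_
    rw [Finset.mem_union, not_or] at hn
    have hfix : ctxSubst (.decl (.u n) .nat :: Γ) (.u n) = .uvar n :=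
      ctxSubst_uvar_eq_self (Γ := Γ) (hL' n hn.2)
    refine (hCons n hn.1).sound ?_ ?_ hCC _
    · exact Prp.mk.injEq .. ▸ ⟨hAs.1.1, by simp only [Ty.subst, hfix]⟩
    simp only [List.forall_mem_cons, Ty.subst, hfix, Ty.vec.injEq, true_and]
    exact ⟨hAs.1.2, hAs.1.2, hAs.2⟩

theorem CoversEq.sound {Γ : Ctx} {P : Prp} {B : Branches} {As : List Ty}
    (h : CoversEq Γ P B As) (hP : P.subst (ctxSubst Γ) = P)
    (hAs : ∀ A ∈ As, A.subst (ctxSubst Γ) = A) {C : Branches} (hC : SamePats B C) (Ψ : DCtx) :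
    DeclCoversEq Ψ P C As := by
  match h with
  | .eq (Δ := Δ) helim h =>
    obtain ⟨hs, ht⟩ := Prp.mk.inj hP
    rw [hs, ht] at helim
    obtain ⟨θ, hθ, hΔ⟩ := helim.sound hs ht
    have hmap : As.map (Ty.subst (ctxSubst Δ)) = As.map (Ty.subst (liftU θ)) :=
      List.map_congr_left fun A hA => by rw [hΔ, hAs A hA]
    refine .eq hθ.isMGU (hmap ▸ h.sound ?_ (hC.subst_subst _ _) _)
    intro A' hA'
    obtain ⟨A, hA, rfl⟩ := List.mem_map.1 hA'
    exact hθ.subst_ctxSubst_idem hΔ hs ht (hAs A hA)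
  | .eqBot helim =>
    obtain ⟨hs, ht⟩ := Prp.mk.inj hP
    rw [hs, ht] at helim
    exact .eqBot (helim.sound hs ht)

end

end Bidir

open Bidir
theorem mainTheorem8 (Γ Ω : Ctx) (B : Branches) (As : List Ty)
    (hΓ : WF Γ) (hΩ : WF Ω) (hcomplete : Complete Ω) (hext : Extends Γ Ω)
    (hprincipal : ArePrincipalTypes Γ As)
    (hfixed : As.map (Ty.subst (ctxSubst Γ)) = As) :
    (Covers Γ B As →
      ∃ Ψ : DCtx, ctxApply Ω Γ = some Ψ ∧ DeclCovers Ψ B As) ∧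
    (∀ P : Prp, P.subst (ctxSubst Γ) = P → CoversEq Γ P B As →
      ∃ Ψ : DCtx, ctxApply Ω Γ = some Ψ ∧ DeclCoversEq Ψ P B As) := by
  obtain ⟨Ψ, hΨ⟩ := hext.exists_ctxApply hΩ hcomplete
  have hAs : ∀ A ∈ As, A.subst (ctxSubst Γ) = A := by
    rw [← List.map_inj_left (g := fun A => A), List.map_id']
    exact hfixed
  exact ⟨fun h => ⟨Ψ, hΨ, h.sound hAs (.refl B) Ψ⟩,
    fun P hP h => ⟨Ψ, hΨ, h.sound hP hAs (.refl B) Ψ⟩⟩
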